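/- Let $\overline{\mathbb Q}\subset\mathbb C$ be the field of algebraic numbers. For a polynomial $f\in\mathbb C[z]$ let $C_f=\{c\in\mathbb C: f'(c)=0\}$, let $f^{\circ n}$ be the $n$-fold composition of $f$ with itself, and let $P_f=\overline{\bigcup_{n>0}f^{\circ n}(C_f)}$; the local degree of a nonconstant $f$ at $z$ is the multiplicity of $z$ as a root of $f-f(z)$. A Belyi polynomial is a nonconstant polynomial with $f(C_f)\subset\{0,1\}$; it is clean if its local degree at every point of $f^{-1}(1)$ is exactly $2$. Let $XDBP$ be the set of extra-clean dynamical Belyi polynomials, that is, of clean Belyi polynomials $f\in\overline{\mathbb Q}[z]$ of degree at least $3$ such that $P_f\subset\{0,1\}$, $f(0)=f(1)=0$, and the local degrees of $f$ at $0$ and at $1$ are both equal to $1$. All iterates of such an $f$ are Belyi polynomials. For a Belyi polynomial $F$ and a base point $b\in\mathbb C\setminus\{0,1\}$, let $\mathrm{Mon}(F)$ be the monodromy group of the covering $F:\mathbb C\setminus F^{-1}(\{0,1\})\to\mathbb C\setminus\{0,1\}$, i.e. the image of $\pi_1(\mathbb C\setminus\{0,1\},b)$ in the group of permutations of the fiber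 $F^{-1}(b)$. Permutation groups $G$ on a set $A$ and $H$ on a set $B$ are permutation-isomorphic if there is a bijection $\tau:A\to B$ with $H=\tau G\tau^{-1}$. For $\sigma\in\mathrm{Gal}(\overline{\mathbb Q}/\mathbb Q)$ let $f^\sigma$ be the polynomial obtained from $f\in\overline{\mathbb Q}[z]$ by applying $\sigma$ to its coefficients. **Theorem.** If $f,g\in XDBP$ and $g=f^\sigma$ for some $\sigma\in\mathrm{Gal}(\overline{\mathbb Q}/\mathbb Q)$, then for every integer $n>0$ the groups $\mathrm{Mon}(f^{\circ n})$ and $\mathrm{Mon}(g^{\circ n})$ are permutation-isomorphic, for any choice of the two base points in $\mathbb C\setminus\{0,1\}$. -/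

import Mathlib

open Polynomial

noncomputable section

/-- The field of algebraic numbers, as a subfield of `ℂ`. -/
abbrev QBar : IntermediateField ℚ ℂ := algebraicClosure ℚ ℂ

namespace BelyiPolynomial

/-- A polynomial with algebraic coefficients, regarded as a complex polynomial. -/
def toComplex (f : QBar[X]) : ℂ[X] := f.map (algebraMap QBar ℂ)

/-- The twist `f^σ`: apply `σ` to every coefficient. -/
def twist (σ : Gal(QBar/ℚ)) (f : QBar[X]) : QBar[X] := f.map (σ : QBar →+* QBar)

/-- The `n`-th iterate `f^{∘n}`, the composition of `n` copies of `f`. -/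
def iter {R : Type*} [CommSemiring R] (f : R[X]) (n : ℕ) : R[X] := f.comp^[n] X

/-- The set `C_F` of (finite) critical points. -/
def criticalPoints (F : ℂ[X]) : Set ℂ := {z | F.derivative.eval z = 0}

/-- The set `V_F = F(C_F)` of (finite) critical values. -/
def criticalValues (F : ℂ[X]) : Set ℂ := (fun z => F.eval z) '' criticalPoints F

/-- The postcritical set `P_F`, the closure of `⋃_{n > 0} F^{∘n}(C_F)`. -/
def postcriticalSet (F : ℂ[X]) : Set ℂ :=
  closure (⋃ n : ℕ, ⋃ _ : 0 < n, (fun z => F.eval z)^[n] '' criticalPoints F)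

/-- The local degree of `F` at `z`: the multiplicity of `z` as a root of `F - F(z)`. -/
def localDegree (F : ℂ[X]) (z : ℂ) : ℕ := (F - C (F.eval z)).rootMultiplicity z

/-- A (not necessarily clean) Belyi polynomial: nonconstant, with finite critical values
in `{0, 1}`. -/
structure IsBelyi (F : ℂ[X]) : Prop where
  natDegree_pos : 0 < F.natDegree
  criticalValues_subset : criticalValues F ⊆ {0, 1}

/-- A clean Belyi polynomial: the ramification at each point over `1` is exactly two. -/
structure IsCleanBelyi (F : ℂ[X]) : Prop extends IsBelyi F where
  localDegree_of_eval_eq_one : ∀ z : ℂ, F.eval z = 1 → localDegree F z = 2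

/-- A dynamical Belyi polynomial. -/
structure IsDBP (F : ℂ[X]) : Prop extends IsCleanBelyi F where
  three_le_natDegree : 3 ≤ F.natDegree
  postcriticalSet_subset : postcriticalSet F ⊆ {0, 1}

/-- An extra-clean dynamical Belyi polynomial. -/
structure IsXDBP (F : ℂ[X]) : Prop extends IsDBP F where
  eval_zero : F.eval 0 = 0
  eval_one : F.eval 1 = 0
  localDegree_zero : localDegree F 0 = 1
  localDegree_one : localDegree F 1 = 1

/-- The set `XDBP` of extra-clean dynamical Belyi polynomials, with algebraic coefficients. -/
def XDBP : Set QBar[X] := {f | IsXDBP (toComplex f)}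

/-- The twice punctured plane `ℂ ∖ {0, 1}`. -/
abbrev puncturedPlane : Set ℂ := {0, 1}ᶜ

/-- The map `F : ℂ ∖ F⁻¹({0, 1}) → ℂ ∖ {0, 1}`. -/
def restrictedMap (F : ℂ[X]) :
    ((fun z => F.eval z) ⁻¹' puncturedPlane : Set ℂ) → puncturedPlane :=
  puncturedPlane.restrictPreimage (fun z => F.eval z)

/-- The fiber of `F` over the base point `b`, on which the monodromy group acts. -/
abbrev Fiber (F : ℂ[X]) (b : puncturedPlane) : Type :=
  (restrictedMap F ⁻¹' {b} : Set ((fun z => F.eval z) ⁻¹' puncturedPlane : Set ℂ))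

theorem IsBelyi.isCoveringMap {F : ℂ[X]} (hF : IsBelyi F) : IsCoveringMap (restrictedMap F) := by
  have h : IsCoveringMapOn (fun z => F.eval z) puncturedPlane := by
    exact F.isCoveringMapOn_eval.mono (Set.compl_subset_compl.mpr hF.criticalValues_subset)
  exact h.isCoveringMap_restrictPreimage

/-- The monodromy group `Mon(F)` of the covering `F : ℂ ∖ F⁻¹({0, 1}) → ℂ ∖ {0, 1}`, as a group
of permutations of the fiber over `b`: the image of the fundamental group of `ℂ ∖ {0, 1}`. -/
def Mon {F : ℂ[X]} (hF : IsBelyi F) (b : puncturedPlane) : Subgroup (Equiv.Perm (Fiber F b)) :=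
  (hF.isCoveringMap.monodromyPerm b).range

/-- Permutation groups `G` on `α` and `H` on `β` are permutation-isomorphic if `H = τ G τ⁻¹` for
some bijection `τ : α → β`. -/
def PermIsomorphic {α β : Type*} (G : Subgroup (Equiv.Perm α)) (H : Subgroup (Equiv.Perm β)) :
    Prop :=
  ∃ τ : α ≃ β, H = G.map (τ.permCongrHom : Equiv.Perm α →* Equiv.Perm β)

theorem toComplex_iter (f : QBar[X]) (n : ℕ) : toComplex (iter f n) = iter (toComplex f) n := by
  induction n with
  | zero => simp [iter, toComplex]
  | succ n ih =>
    simp only [iter, Function.iterate_succ_apply'] at ih ⊢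
    rw [← ih]
    simp [toComplex, Polynomial.map_comp]

/-- Every iterate of a dynamical Belyi polynomial is a (not necessarily clean) Belyi polynomial. -/
theorem IsDBP.isBelyi_iter {F : ℂ[X]} (hF : IsDBP F) (n : ℕ) : IsBelyi (iter F n) := by
  have key : ∀ (n : ℕ) (z : ℂ), (iter F n).derivative.eval z = 0 →
      ∃ c ∈ criticalPoints F, ∃ m : ℕ, 0 < m ∧ (fun w => F.eval w)^[m] c = (iter F n).eval z := by
    intro n
    induction n with
    | zero => intro z hz; simp [iter] at hz
    | succ n ih =>
      intro z hz
      have hs : iter F (n + 1) = F.comp (iter F n) := by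
        simp only [iter, Function.iterate_succ_apply']
      rw [hs, derivative_comp, eval_mul, eval_comp, mul_eq_zero] at hz
      rcases hz with hz | hz
      · obtain ⟨c, hc, m, -, hmc⟩ := ih z hz
        exact ⟨c, hc, m + 1, Nat.succ_pos m, by
          rw [Function.iterate_succ_apply', hmc, hs, eval_comp]⟩
      · exact ⟨(iter F n).eval z, hz, 1, one_pos, by rw [hs, eval_comp]; rfl⟩
  refine ⟨?_, ?_⟩
  · simp only [iter, natDegree_iterate_comp, natDegree_X, mul_one]
    exact pow_pos hF.natDegree_pos n
  · rintro _ ⟨z, hz, rfl⟩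
    obtain ⟨c, hc, m, hm, hmc⟩ := key n z hz
    refine hF.postcriticalSet_subset (subset_closure ?_)
    exact Set.mem_iUnion₂.mpr ⟨m, hm, c, hc, hmc⟩

theorem isBelyi_toComplex_iter {f : QBar[X]} (hf : f ∈ XDBP) (n : ℕ) :
    IsBelyi (toComplex (iter f n)) := by
  rw [toComplex_iter]
  exact IsDBP.isBelyi_iter (IsXDBP.toIsDBP hf) n

end BelyiPolynomial

end

/-!
A field automorphism of `ℚ̄` extends to an automorphism `σ` of `ℂ`, so it suffices to compare a
Belyi polynomial `F` with its conjugate `G = F^σ`. A polynomial in the points of the fiber of `F`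
that is invariant under `Mon(F)` is a single-valued holomorphic function of the base point, of
polynomial growth, hence a polynomial `c` in the base point. Although `σ` is discontinuous, it
fixes the rational points and there maps fibers of `F` to fibers of `G`. The relation
expressing `c` through the fiber of `F` therefore becomes, at infinitely many points near a
rational base point, a relation between `c^σ` and the fiber of `G`; by analytic continuation it
holds everywhere and survives all monodromy of `G`. For an invariant that separates `Mon(F)` from
the remaining permutations this puts `Mon(G)` inside a conjugate of `Mon(F)`, and exchanging the
two polynomials gives equality.
-/

noncomputable section

open Filter Topology

namespace BelyiPolynomial

/-! ### Extension of automorphisms and separating polynomials -/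

theorem exists_ringEquiv_algebraMap_eq {K L : Type*} [Field K] [Field L] [IsAlgClosed L]
    [Algebra K L] (σ : K ≃+* K) :
    ∃ φ : L ≃+* L, ∀ x, φ (algebraMap K L x) = algebraMap K L (σ x) := by
  obtain ⟨s, hs⟩ := exists_isTranscendenceBasis K L
  let A := Algebra.adjoin K (Set.range ((↑) : s → L))
  have : IsAlgClosure A L := IsAlgClosed.isAlgClosure_of_transcendence_basis _ hs
  let e : MvPolynomial s K ≃ₐ[K] A := hs.1.aevalEquiv
  let ε : A ≃+* A := (e.symm.toRingEquiv.trans (MvPolynomial.mapEquiv s σ)).trans e.toRingEquiv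
  have hε (x : K) : ε (algebraMap K A x) = algebraMap K A (σ x) := by
    simp [ε, MvPolynomial.algebraMap_eq, ← e.commutes]
  refine ⟨IsAlgClosure.equivOfEquiv L L ε, fun x => ?_⟩
  rw [IsScalarTower.algebraMap_apply K A L, IsAlgClosure.equivOfEquiv_algebraMap, hε,
    ← IsScalarTower.algebraMap_apply]

theorem eval_map_apply_of_apply_eq {R : Type*} [Semiring R] {σ : R ≃+* R} {t : R} (ht : σ t = t)
    (c : R[X]) : (c.map (σ : R →+* R)).eval t = σ (c.eval t) := by
  conv_lhs => rw [← ht]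
  exact eval_map_apply (σ : R →+* R) t

theorem eq_map_of_le_map_of_le_map {A B : Type*} [Group A] [Group B] [Finite B]
    {G : Subgroup A} {H : Subgroup B} {φ : A ≃* B} {ψ : B ≃* A}
    (hH : H ≤ G.map (φ : A →* B)) (hG : G ≤ H.map (ψ : B →* A)) : H = G.map (φ : A →* B) := by
  have : Finite A := .of_equiv B φ.symm.toEquiv
  refine Subgroup.eq_of_le_of_card_ge hH ?_
  calc Nat.card (G.map (φ : A →* B)) = Nat.card G := Subgroup.card_map_of_injective φ.injective
    _ ≤ Nat.card (H.map (ψ : B →* A)) := Subgroup.card_le_of_le hG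
    _ = Nat.card H := Subgroup.card_map_of_injective ψ.injective

theorem exists_eval_comp_ne_zero_iff_eq_one {ι R : Type*} [Finite ι] [CommRing R] [IsDomain R]
    {z : ι → R} (hz : Function.Injective z) :
    ∃ Q : MvPolynomial ι R, ∀ ρ : Equiv.Perm ι, MvPolynomial.eval (z ∘ ρ) Q ≠ 0 ↔ ρ = 1 := by
  classical
  cases nonempty_fintype ι
  refine ⟨∏ i, ∏ j ∈ Finset.univ.erase i, (MvPolynomial.X i - MvPolynomial.C (z j)), fun ρ => ?_⟩
  simp only [map_prod, map_sub, MvPolynomial.eval_X, MvPolynomial.eval_C, Function.comp_apply,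
    Finset.prod_ne_zero_iff, sub_ne_zero, hz.ne_iff, Finset.mem_univ, forall_const,
    Finset.mem_erase, and_true]
  exact ⟨fun h => Equiv.ext fun i => by_contra fun hi => h i _ hi rfl,
    fun h i j hij => by simpa [h] using hij.symm⟩

theorem exists_rename_eq_and_eval_comp_ne_zero_iff_mem {ι R : Type*} [Finite ι] [CommRing R]
    [IsDomain R] (G : Subgroup (Equiv.Perm ι)) {z : ι → R} (hz : Function.Injective z) :
    ∃ P : MvPolynomial ι R, (∀ ρ ∈ G, MvPolynomial.rename ρ P = P) ∧
      ∀ ρ : Equiv.Perm ι, MvPolynomial.eval (z ∘ ρ) P ≠ 0 ↔ ρ ∈ G := by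
  cases nonempty_fintype G
  obtain ⟨Q, hQ⟩ := exists_eval_comp_ne_zero_iff_eq_one hz
  have heval (ρ : Equiv.Perm ι) (g : G) :
      MvPolynomial.eval (z ∘ ρ) (MvPolynomial.rename g Q) ≠ 0 ↔ ρ = (g : Equiv.Perm ι)⁻¹ := by
    rw [MvPolynomial.eval_rename, Function.comp_assoc, ← Equiv.Perm.coe_mul, hQ,
      mul_eq_one_iff_eq_inv]
  refine ⟨∑ g : G, MvPolynomial.rename g Q, fun ρ hρ => ?_, fun ρ => ?_⟩
  · rw [map_sum]
    refine Fintype.sum_equiv (Equiv.mulLeft ⟨ρ, hρ⟩) _ _ fun g => ?_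
    rw [MvPolynomial.rename_rename]
    rfl
  · rw [map_sum]
    refine ⟨fun h => ?_, fun hρ => ?_⟩
    · obtain ⟨g, -, hg⟩ := Finset.exists_ne_zero_of_sum_ne_zero h
      exact (heval ρ g).mp hg ▸ G.inv_mem g.2
    · rw [Fintype.sum_eq_single (⟨ρ, hρ⟩⁻¹ : G) fun g hg => of_not_not fun h =>
        hg (inv_eq_iff_eq_inv.mpr (Subtype.ext ((heval ρ g).mp h))).symm]
      exact (heval ρ _).mpr (inv_inv ρ).symm

/-! ### Analytic functions -/

theorem exists_norm_le_mul_one_add_norm_eval {F : ℂ[X]} (hF : 0 < F.natDegree) :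
    ∃ K, 0 ≤ K ∧ ∀ z, ‖z‖ ≤ K * (1 + ‖F.eval z‖) := by
  have hdeg : (X : ℂ[X]).degree ≤ F.degree := by
    rw [degree_X, Nat.WithBot.one_le_iff_zero_lt]
    exact natDegree_pos_iff_degree_pos.mp hF
  obtain ⟨c, hc, hlarge⟩ := (isBigO_cobounded_of_degree_le hdeg).exists_pos
  obtain ⟨r, -, hr⟩ := hasBasis_cobounded_norm.eventually_iff.mp hlarge.bound
  refine ⟨max c r, hc.le.trans (le_max_left c r), fun z => ?_⟩
  rcases le_or_gt r ‖z‖ with hz | hz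
  · calc ‖z‖ ≤ c * ‖F.eval z‖ := by simpa using hr hz
      _ ≤ max c r * (1 + ‖F.eval z‖) := by gcongr <;> simp
  · calc ‖z‖ ≤ max c r * 1 := by simp [hz.le]
      _ ≤ max c r * (1 + ‖F.eval z‖) := by gcongr; simp

theorem exists_eval_eq_of_differentiable {φ : ℂ → ℂ} (hφ : Differentiable ℂ φ) {K : ℝ} {N : ℕ}
    (hb : ∀ᶠ t in Bornology.cobounded ℂ, ‖φ t‖ ≤ K * (1 + ‖t‖) ^ N) :
    ∃ c : ℂ[X], ∀ t, c.eval t = φ t := by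
  have hzero : ∀ n, N < n → iteratedDeriv n φ 0 = 0 := by
    intro n hn
    have hlim : Tendsto (fun R : ℝ => n.factorial * K * ((1 + R) ^ N / R ^ n)) atTop (𝓝 0) := by
      have hdeg : ((1 + X : ℝ[X]) ^ N).degree < (X ^ n : ℝ[X]).degree := by
        rw [add_comm, ← C_1, degree_pow, degree_X_add_C, degree_X_pow]
        simpa using hn
      simpa using (div_tendsto_atTop_zero_of_degree_lt _ _ hdeg).const_mul (n.factorial * K)
    obtain ⟨r, -, hr⟩ := hasBasis_cobounded_norm.eventually_iff.mp hb
    refine norm_le_zero_iff.mp (ge_of_tendsto hlim ?_)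
    filter_upwards [eventually_gt_atTop 0, eventually_ge_atTop r] with R hR hrR
    have hcauchy := Complex.norm_iteratedDeriv_le_of_forall_mem_sphere_norm_le (c := 0) n hR
      hφ.diffContOnCl (C := K * (1 + R) ^ N) fun z hz => by
        rw [mem_sphere_zero_iff_norm] at hz
        simpa only [hz] using hr (show r ≤ ‖z‖ from hrR.trans_eq hz.symm)
    exact hcauchy.trans_eq (by ring)
  refine ⟨∑ n ∈ Finset.range (N + 1), C ((n.factorial : ℂ)⁻¹ * iteratedDeriv n φ 0) * X ^ n,
    fun t => ?_⟩
  rw [← Complex.taylorSeries_eq_of_entire' 0 t hφ, tsum_eq_sum (s := Finset.range (N + 1))]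
  · simp [eval_finsetSum]
  · intro n hn
    rw [hzero n (by simpa using hn)]
    simp

theorem exists_differentiable_eqOn_compl {φ : ℂ → ℂ} {S : Set ℂ} (hS : S.Finite)
    (hφ : DifferentiableOn ℂ φ Sᶜ) (hb : ∀ s ∈ S, φ =O[𝓝[≠] s] (1 : ℂ → ℝ)) :
    ∃ ψ : ℂ → ℂ, Differentiable ℂ ψ ∧ Set.EqOn ψ φ Sᶜ := by
  have htendsto {t : ℂ} (ht : t ∈ Sᶜ) : Tendsto φ (𝓝[≠] t) (𝓝 (φ t)) :=
    (hφ.differentiableAt (hS.isClosed.isOpen_compl.mem_nhds ht)).continuousAt.tendsto.mono_left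
      nhdsWithin_le_nhds
  refine ⟨fun t => limUnder (𝓝[≠] t) φ, fun t => ?_, fun t ht => (htendsto ht).limUnder_eq⟩
  have hpunct : Sᶜ ∈ 𝓝[≠] t :=
    Set.compl_eq_univ_sdiff S ▸ nhdsNE_of_nhdsNE_sdiff_finite univ_mem hS
  have hupdate : (fun t => limUnder (𝓝[≠] t) φ) =ᶠ[𝓝 t]
      Function.update φ t (limUnder (𝓝[≠] t) φ) := by
    filter_upwards [eventually_nhdsWithin_iff.mp hpunct] with u hu
    rcases eq_or_ne u t with rfl | hut
    · rw [Function.update_self]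
    · rw [Function.update_of_ne hut, (htendsto (hu hut)).limUnder_eq]
  have hbounded : φ =O[𝓝[≠] t] (1 : ℂ → ℝ) := by
    by_cases ht : t ∈ S
    exacts [hb t ht, (htendsto ht).isBigO_one ℝ]
  have hsub : (fun u => φ u - φ t) =O[𝓝[≠] t] (1 : ℂ → ℝ) :=
    hbounded.sub (Asymptotics.isBigO_const_one ℝ _ _)
  refine DifferentiableAt.congr_of_eventuallyEq ?_ hupdate
  exact (Complex.differentiableOn_update_limUnder_insert_of_isLittleO hpunct hφ
    ((Asymptotics.isBigO_one_iff ℝ).mp hsub).isLittleO_sub_self_inv).differentiableAt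
    (insert_mem_nhds_iff.mpr hpunct)

theorem exists_eval_eq_of_differentiableOn_compl {φ : ℂ → ℂ} {S : Set ℂ} (hS : S.Finite)
    (hφ : DifferentiableOn ℂ φ Sᶜ) {K : ℝ} {N : ℕ} (hb : ∀ t ∈ Sᶜ, ‖φ t‖ ≤ K * (1 + ‖t‖) ^ N) :
    ∃ c : ℂ[X], ∀ t ∈ Sᶜ, c.eval t = φ t := by
  have hlocal : ∀ s ∈ S, φ =O[𝓝[≠] s] (1 : ℂ → ℝ) := by
    intro s _
    have hpunct : Sᶜ ∈ 𝓝[≠] s :=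
      Set.compl_eq_univ_sdiff S ▸ nhdsNE_of_nhdsNE_sdiff_finite univ_mem hS
    have hcont : ContinuousAt (fun t : ℂ => K * (1 + ‖t‖) ^ N) s := by fun_prop
    exact (Asymptotics.IsBigO.of_norm_eventuallyLE (mem_of_superset hpunct hb)).trans
      ((hcont.tendsto.mono_left nhdsWithin_le_nhds).isBigO_one ℝ)
  obtain ⟨ψ, hψ, hψφ⟩ := exists_differentiable_eqOn_compl hS hφ hlocal
  obtain ⟨c, hc⟩ := exists_eval_eq_of_differentiable hψ (K := K) (N := N) <| by
    filter_upwards [Bornology.isBounded_def.mp hS.isBounded] with t ht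
    exact (hψφ ht).symm ▸ hb t ht
  exact ⟨c, fun t ht => (hc t).trans (hψφ ht)⟩

theorem exists_norm_eval_le {ι 𝕜 : Type*} [Fintype ι] [NormedField 𝕜] (P : MvPolynomial ι 𝕜) :
    ∃ (A : ℝ) (N : ℕ), 0 ≤ A ∧ ∀ x : ι → 𝕜, ‖MvPolynomial.eval x P‖ ≤ A * (1 + ‖x‖) ^ N := by
  induction P using MvPolynomial.induction_on with
  | C a => exact ⟨‖a‖, 0, norm_nonneg a, fun x => by simp⟩
  | add P Q hP hQ =>
    obtain ⟨A, M, hA, hP⟩ := hP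
    obtain ⟨B, N, hB, hQ⟩ := hQ
    refine ⟨A + B, max M N, add_nonneg hA hB, fun x => ?_⟩
    have hx : 1 ≤ 1 + ‖x‖ := by simp
    calc ‖MvPolynomial.eval x (P + Q)‖ ≤ A * (1 + ‖x‖) ^ M + B * (1 + ‖x‖) ^ N := by
          rw [map_add]; exact norm_add_le_of_le (hP x) (hQ x)
      _ ≤ (A + B) * (1 + ‖x‖) ^ max M N := by
          rw [add_mul]; gcongr <;> simp
  | mul_X P i hP =>
    obtain ⟨A, N, hA, hP⟩ := hP
    refine ⟨A, N + 1, hA, fun x => ?_⟩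
    rw [map_mul, MvPolynomial.eval_X, norm_mul, pow_succ, ← mul_assoc]
    gcongr
    · exact hP x
    · linarith [norm_le_pi_norm x i]

theorem eventually_eventuallyEq_zero_eq {𝕜 E : Type*} [NontriviallyNormedField 𝕜]
    [NormedAddCommGroup E] [NormedSpace 𝕜 E] {g : 𝕜 → E} {t : 𝕜} (hg : AnalyticAt 𝕜 g t) :
    ∀ᶠ u in 𝓝 t, (g =ᶠ[𝓝 u] 0) = (g =ᶠ[𝓝 t] 0) := by
  rcases hg.eventually_eq_zero_or_eventually_ne_zero with h | h
  · filter_upwards [h.eventually_nhds] with u hu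
    exact propext ⟨fun _ => h, fun _ => hu⟩
  · have hne : ¬ g =ᶠ[𝓝 t] 0 := fun h0 =>
      (h.and (h0.filter_mono nhdsWithin_le_nhds)).exists.elim fun _ hu => hu.1 hu.2
    filter_upwards [eventually_nhdsWithin_iff.mp h] with u hu
    rcases eq_or_ne u t with rfl | hut
    · rfl
    · exact propext ⟨fun h0 => (hu hut h0.self_of_nhds).elim, fun h0 => (hne h0).elim⟩

/-! ### Path lifting and monodromy -/

section CoveringMap

variable {E B : Type*} [TopologicalSpace E] [TopologicalSpace B] {p : E → B}
  (cov : IsCoveringMap p) {x y : B}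

/-- The bijection between two fibers of a covering map given by lifting paths in a homotopy
class. -/
def monodromyEquiv (γ : Path.Homotopic.Quotient x y) : p ⁻¹' {x} ≃ p ⁻¹' {y} where
  toFun := cov.monodromy γ
  invFun := cov.monodromy γ.symm
  left_inv e := by
    rw [← cov.monodromy_trans_apply, Path.Homotopic.Quotient.trans_symm, cov.monodromy_refl, id]
  right_inv e := by
    rw [← cov.monodromy_trans_apply, Path.Homotopic.Quotient.symm_trans, cov.monodromy_refl, id]

theorem range_monodromyPerm_eq_map (γ : Path.Homotopic.Quotient x y) :
    (cov.monodromyPerm y).range =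
      (cov.monodromyPerm x).range.map ((monodromyEquiv cov γ).permCongrHom :
        Equiv.Perm (p ⁻¹' {x}) →* Equiv.Perm (p ⁻¹' {y})) := by
  let τ := monodromyEquiv cov γ
  apply le_antisymm
  · rintro _ ⟨δ, rfl⟩
    refine ⟨_, ⟨(γ.trans δ).trans γ.symm, rfl⟩, Equiv.ext fun e => ?_⟩
    change τ (cov.monodromy ((γ.trans δ).trans γ.symm) (τ.symm e)) = cov.monodromy δ e
    rw [cov.monodromy_trans_apply, cov.monodromy_trans_apply]
    exact (τ.apply_symm_apply _).trans (congr_arg _ (τ.apply_symm_apply e))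
  · rintro _ ⟨_, ⟨δ, rfl⟩, rfl⟩
    refine ⟨(γ.symm.trans δ).trans γ, Equiv.ext fun e => ?_⟩
    rw [cov.coe_monodromyPerm, cov.monodromy_trans_apply, cov.monodromy_trans_apply]
    rfl

end CoveringMap

theorem PermIsomorphic.trans {α β γ : Type*} {G : Subgroup (Equiv.Perm α)}
    {H : Subgroup (Equiv.Perm β)} {K : Subgroup (Equiv.Perm γ)} (hGH : PermIsomorphic G H)
    (hHK : PermIsomorphic H K) : PermIsomorphic G K := by
  obtain ⟨τ, rfl⟩ := hGH
  obtain ⟨υ, rfl⟩ := hHK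
  refine ⟨τ.trans υ, ?_⟩
  rw [Subgroup.map_map]
  rfl

theorem isOpen_puncturedPlane : IsOpen puncturedPlane :=
  (Set.toFinite ({0, 1} : Set ℂ)).isClosed.isOpen_compl

instance : PathConnectedSpace puncturedPlane :=
  isPathConnected_iff_pathConnectedSpace.mp <|
    (Set.toFinite ({0, 1} : Set ℂ)).countable.isPathConnected_compl_of_one_lt_rank
      (by rw [Complex.rank_real_complex]; norm_num)

instance : LocallyPathConnectedSpace puncturedPlane :=
  isOpen_puncturedPlane.locallyPathConnectedSpace

section Fiber

variable {F : ℂ[X]} {b t : puncturedPlane}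

theorem Fiber.eval_eq (e : Fiber F b) : F.eval e.1.1 = b.1 :=
  congr_arg Subtype.val e.2

theorem Fiber.coe_injective : Function.Injective fun e : Fiber F b => e.1.1 :=
  Subtype.val_injective.comp Subtype.val_injective

/-- A preimage of `b` as a point of the fiber. -/
def Fiber.mk (z : ℂ) (hz : F.eval z = b.1) : Fiber F b :=
  ⟨⟨z, by rw [Set.mem_preimage, hz]; exact b.2⟩, Subtype.ext hz⟩

/-- Conjugation by a field automorphism `σ` maps the fiber of `F` over a point fixed by `σ` to the
fiber of `F^σ`. -/
def Fiber.conj (F : ℂ[X]) {σ : ℂ ≃+* ℂ} (ht : σ t = t) :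
    Fiber F t ≃ Fiber (F.map (σ : ℂ →+* ℂ)) t where
  toFun e := .mk (σ e.1.1) <|
    (eval_map_apply (σ : ℂ →+* ℂ) e.1.1).trans ((congr_arg σ e.eval_eq).trans ht)
  invFun e := .mk (σ.symm e.1.1) <| σ.injective <| by
    rw [ht, ← e.eval_eq, ← RingEquiv.coe_toRingHom, ← eval_map_apply, RingEquiv.coe_toRingHom,
      σ.apply_symm_apply]
  left_inv e := Fiber.coe_injective (σ.symm_apply_apply e.1.1)
  right_inv e := Fiber.coe_injective (σ.apply_symm_apply e.1.1)

theorem mon_permIsomorphic_mon (hF : IsBelyi F) (b t : puncturedPlane) :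
    PermIsomorphic (Mon hF b) (Mon hF t) :=
  ⟨_, range_monodromyPerm_eq_map hF.isCoveringMap (.mk (PathConnectedSpace.somePath b t))⟩

end Fiber

namespace IsBelyi

variable {F : ℂ[X]} (hF : IsBelyi F) {b t u : puncturedPlane}

theorem finite_fiber (hF : IsBelyi F) (b : puncturedPlane) : Finite (Fiber F b) := by
  have hne : F - C b.1 ≠ 0 :=
    ne_zero_of_natDegree_gt (n := 0) (natDegree_sub_C.trans_gt hF.natDegree_pos)
  refine Finite.of_injective (fun e : Fiber F b => (⟨e.1.1, ?_⟩ : (F - C b.1).rootSet ℂ))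
    fun e e' h => Fiber.coe_injective (Subtype.mk.inj h)
  simp [mem_rootSet, hne, e.eval_eq]

/-- The bijection between two fibers given by lifting paths in a homotopy class. -/
def transport (γ : Path.Homotopic.Quotient b t) : Fiber F b ≃ Fiber F t :=
  monodromyEquiv hF.isCoveringMap γ

/-- The end point, as a complex number, of the lift through `e` of a path in the class `γ`. -/
def endpoint (γ : Path.Homotopic.Quotient b t) (e : Fiber F b) : ℂ := (hF.transport γ e).1.1

theorem eval_endpoint (γ : Path.Homotopic.Quotient b t) (e : Fiber F b) :
    F.eval (hF.endpoint γ e) = t :=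
  (hF.transport γ e).eval_eq

theorem endpoint_trans (γ : Path.Homotopic.Quotient b t) (δ : Path.Homotopic.Quotient t u) :
    hF.endpoint (γ.trans δ) = hF.endpoint δ ∘ hF.transport γ := by
  funext e
  exact congr_arg (·.1.1) (hF.isCoveringMap.monodromy_trans_apply γ δ e)

theorem exists_continuous_lift (γ : Path b t) (e : Fiber F b) :
    ∃ w : unitInterval → ℂ, Continuous w ∧ (∀ s, F.eval (w s) = γ s) ∧ w 0 = e.1.1 ∧
      w 1 = hF.endpoint (.mk γ) e := by
  have hstart : γ 0 = restrictedMap F e.1 := γ.source.trans e.2.symm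
  let Γ := hF.isCoveringMap.liftPath γ e.1 hstart
  refine ⟨fun s => (Γ s).1, continuous_subtype_val.comp Γ.continuous, fun s => ?_, ?_, rfl⟩
  · exact congr_arg Subtype.val (congr_fun (hF.isCoveringMap.liftPath_lifts γ e.1 hstart) s)
  · exact congr_arg Subtype.val (hF.isCoveringMap.liftPath_zero γ e.1 hstart)

theorem endpoint_mk_eq_of_lift {γ : Path b t} {e : Fiber F b} {w : unitInterval → ℂ}
    (hw : Continuous w) (hlift : ∀ s, F.eval (w s) = γ s) (h0 : w 0 = e.1.1) :
    hF.endpoint (.mk γ) e = w 1 := by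
  have hmem (s) : w s ∈ (fun z => F.eval z) ⁻¹' puncturedPlane := by
    rw [Set.mem_preimage, hlift]
    exact (γ s).2
  let Γ : C(unitInterval, (fun z => F.eval z) ⁻¹' puncturedPlane) :=
    ⟨fun s => ⟨w s, hmem s⟩, hw.subtype_mk hmem⟩
  have hΓ : Γ = hF.isCoveringMap.liftPath γ e.1 (γ.source.trans e.2.symm) :=
    (hF.isCoveringMap.eq_liftPath_iff' _).mpr
      ⟨funext fun s => Subtype.ext (hlift s), Subtype.ext h0⟩
  exact congr_arg Subtype.val (DFunLike.congr_fun hΓ.symm 1)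

theorem deriv_eval_ne_zero (hF : IsBelyi F) (e : Fiber F b) :
    deriv (fun z => F.eval z) e.1.1 ≠ 0 := by
  rw [F.deriv]
  exact fun h => b.2 (e.eval_eq ▸ hF.criticalValues_subset ⟨e.1.1, h, rfl⟩)

/-- The local inverse of `F` near `b` with value `e` at `b`; it is junk far from `b`. -/
def localSection (e : Fiber F b) : ℂ → ℂ :=
  (AnalyticOnNhd.eval_polynomial F e.1.1 trivial).hasStrictDerivAt.localInverse _ _ _
    (hF.deriv_eval_ne_zero e)

theorem analyticAt_localSection (e : Fiber F b) : AnalyticAt ℂ (hF.localSection e) b := by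
  rw [← e.eval_eq]
  exact (AnalyticOnNhd.eval_polynomial F e.1.1 trivial).analyticAt_localInverse
    (hF.deriv_eval_ne_zero e)

theorem localSection_apply_self (e : Fiber F b) : hF.localSection e b = e.1.1 := by
  rw [← e.eval_eq]
  exact HasStrictFDerivAt.localInverse_apply_image _

theorem eventually_eval_localSection (e : Fiber F b) :
    ∀ᶠ t in 𝓝 b.1, F.eval (hF.localSection e t) = t := by
  rw [← e.eval_eq]
  exact (AnalyticOnNhd.eval_polynomial F e.1.1 trivial).hasStrictDerivAt.eventually_right_inverse
    (hF.deriv_eval_ne_zero e)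

theorem eventually_localSection_eval (e : Fiber F b) :
    ∀ᶠ z in 𝓝 e.1.1, hF.localSection e (F.eval z) = z :=
  (AnalyticOnNhd.eval_polynomial F e.1.1 trivial).hasStrictDerivAt.eventually_left_inverse
    (hF.deriv_eval_ne_zero e)

theorem eventually_exists_localSection_eq_endpoint (b : puncturedPlane) :
    ∀ᶠ t in 𝓝 b.1, ∃ (ht : t ∈ puncturedPlane) (γ : Path.Homotopic.Quotient b ⟨t, ht⟩),
      ∀ e, hF.localSection e t = hF.endpoint γ e := by
  have := hF.finite_fiber b
  have hsections : ∀ᶠ t : puncturedPlane in 𝓝 b, ∀ e : Fiber F b,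
      ContinuousAt (hF.localSection e) t ∧ F.eval (hF.localSection e t) = t :=
    eventually_all.mpr fun e => continuous_subtype_val.continuousAt.eventually
      (((hF.analyticAt_localSection e).eventually_analyticAt.mono fun _ h => h.continuousAt).and
        (hF.eventually_eval_localSection e))
  obtain ⟨V, ⟨hV, hVconn⟩, hVs⟩ := (path_connected_basis b).mem_iff.mp hsections
  rw [← isOpen_puncturedPlane.isOpenEmbedding_subtypeVal.map_nhds_eq b, eventually_map]
  filter_upwards [hV] with t ht
  obtain ⟨γ, hγ⟩ := hVconn.joinedIn b (mem_of_mem_nhds hV) t ht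
  refine ⟨t.2, .mk γ, fun e => ?_⟩
  rw [hF.endpoint_mk_eq_of_lift (w := fun s => hF.localSection e (γ s)), γ.target]
  · exact continuous_iff_continuousAt.mpr fun s =>
      (hVs (hγ s) e).1.comp (f := fun s => (γ s).1)
        (continuous_subtype_val.comp γ.continuous).continuousAt
  · exact fun s => (hVs (hγ s) e).2
  · rw [γ.source, hF.localSection_apply_self]

theorem mem_mon_iff {ρ : Equiv.Perm (Fiber F b)} :
    ρ ∈ Mon hF b ↔ ∃ γ : Path.Homotopic.Quotient b b, hF.transport γ = ρ :=
  exists_congr fun _ => by rw [Equiv.ext_iff, Equiv.ext_iff]; rfl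

/-! ### Functions invariant under monodromy -/

section InvariantPolynomial

variable {P : MvPolynomial (Fiber F b) ℂ}

theorem eval_endpoint_eq_eval_endpoint (hP : ∀ ρ ∈ Mon hF b, MvPolynomial.rename ρ P = P)
    (γ δ : Path.Homotopic.Quotient b t) :
    MvPolynomial.eval (hF.endpoint γ) P = MvPolynomial.eval (hF.endpoint δ) P := by
  have hγ : γ = (γ.trans δ.symm).trans δ := by
    rw [Path.Homotopic.Quotient.trans_assoc, Path.Homotopic.Quotient.symm_trans,
      Path.Homotopic.Quotient.trans_refl]
  rw [hγ, hF.endpoint_trans, ← MvPolynomial.eval_rename, hP _ (hF.mem_mon_iff.mpr ⟨_, rfl⟩)]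

theorem differentiableOn_of_eq_eval_endpoint {φ : ℂ → ℂ}
    (hφ : ∀ (t : puncturedPlane) (γ : Path.Homotopic.Quotient b t),
      φ t = MvPolynomial.eval (hF.endpoint γ) P) :
    DifferentiableOn ℂ φ puncturedPlane := by
  intro t ht
  lift t to puncturedPlane using ht
  let γ : Path.Homotopic.Quotient b t := .mk (PathConnectedSpace.somePath b t)
  have hφ_eq : φ =ᶠ[𝓝 t.1] fun u =>
      MvPolynomial.aeval (fun e => hF.localSection (hF.transport γ e) u) P := by
    filter_upwards [hF.eventually_exists_localSection_eq_endpoint t] with u ⟨hu, δ, hδ⟩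
    rw [hφ ⟨u, hu⟩ (γ.trans δ), hF.endpoint_trans, MvPolynomial.aeval_eq_eval]
    simp only [hδ]
    rfl
  have := AnalyticAt.aeval_mvPolynomial
    (fun e => hF.analyticAt_localSection (hF.transport γ e)) P
  exact (this.congr hφ_eq.symm).differentiableAt.differentiableWithinAt

theorem exists_norm_eval_endpoint_le (P : MvPolynomial (Fiber F b) ℂ) :
    ∃ (A : ℝ) (N : ℕ), ∀ (t : puncturedPlane) (γ : Path.Homotopic.Quotient b t),
      ‖MvPolynomial.eval (hF.endpoint γ) P‖ ≤ A * (1 + ‖t.1‖) ^ N := by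
  have := hF.finite_fiber b
  cases nonempty_fintype (Fiber F b)
  obtain ⟨K, hK, hroot⟩ := exists_norm_le_mul_one_add_norm_eval hF.natDegree_pos
  obtain ⟨A, N, hA, hP⟩ := exists_norm_eval_le P
  refine ⟨A * (1 + K) ^ N, N, fun t γ => ?_⟩
  have hendpoint : ‖hF.endpoint γ‖ ≤ K * (1 + ‖t.1‖) :=
    (pi_norm_le_iff_of_nonneg (by positivity)).mpr fun e => hF.eval_endpoint γ e ▸ hroot _
  calc ‖MvPolynomial.eval (hF.endpoint γ) P‖
      ≤ A * (1 + ‖hF.endpoint γ‖) ^ N := hP _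
    _ ≤ A * ((1 + K) * (1 + ‖t.1‖)) ^ N := by
        gcongr
        linarith [norm_nonneg t.1]
    _ = A * (1 + K) ^ N * (1 + ‖t.1‖) ^ N := by rw [mul_pow, mul_assoc]

theorem exists_eval_eq_eval_endpoint (hP : ∀ ρ ∈ Mon hF b, MvPolynomial.rename ρ P = P) :
    ∃ c : ℂ[X], ∀ (t : puncturedPlane) (γ : Path.Homotopic.Quotient b t),
      c.eval t.1 = MvPolynomial.eval (hF.endpoint γ) P := by
  let φ : ℂ → ℂ := Function.extend Subtype.val (fun t : puncturedPlane =>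
    MvPolynomial.eval (hF.endpoint (.mk (PathConnectedSpace.somePath b t))) P) 0
  have hφ (t : puncturedPlane) (γ : Path.Homotopic.Quotient b t) :
      φ t = MvPolynomial.eval (hF.endpoint γ) P :=
    (Subtype.val_injective.extend_apply _ _ t).trans (hF.eval_endpoint_eq_eval_endpoint hP _ γ)
  obtain ⟨A, N, hbound⟩ := hF.exists_norm_eval_endpoint_le P
  obtain ⟨c, hc⟩ := exists_eval_eq_of_differentiableOn_compl (Set.toFinite {0, 1})
    (hF.differentiableOn_of_eq_eval_endpoint hφ) (K := A) (N := N) fun t ht =>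
      hφ ⟨t, ht⟩ (.mk (PathConnectedSpace.somePath b ⟨t, ht⟩)) ▸ hbound ⟨t, ht⟩ _
  exact ⟨c, fun t γ => (hc t t.2).trans (hφ t γ)⟩

end InvariantPolynomial

/-! ### Analytic continuation along paths -/

section Continuation

theorem eventually_localSection_eventuallyEq (e : Fiber F b) :
    ∀ᶠ z in 𝓝 e.1.1, ∀ (t : puncturedPlane) (e' : Fiber F t), e'.1.1 = z →
      hF.localSection e' =ᶠ[𝓝 t.1] hF.localSection e := by
  filter_upwards [(hF.eventually_localSection_eval e).eventually_nhds] with z hz t e' rfl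
  have htendsto : Tendsto (hF.localSection e') (𝓝 t.1) (𝓝 e'.1.1) := by
    simpa only [ContinuousAt, hF.localSection_apply_self] using
      (hF.analyticAt_localSection e').continuousAt
  filter_upwards [htendsto.eventually hz, hF.eventually_eval_localSection e'] with u hu hu'
  rw [← hu, hu']

variable {ι : Type*} [Fintype ι] {f : ℂ × (ι → ℂ) → ℂ}

/-- The germ at `b` obtained by substituting the local inverses through the points `e i` into
the analytic function `f` of a point and a tuple of preimages. -/
def germ (f : ℂ × (ι → ℂ) → ℂ) (e : ι → Fiber F b) (t : ℂ) : ℂ :=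
  f (t, fun i => hF.localSection (e i) t)

theorem analyticAt_germ (hf : AnalyticOnNhd ℂ f Set.univ) (e : ι → Fiber F b) :
    AnalyticAt ℂ (hF.germ f e) b :=
  (hf _ trivial).comp (analyticAt_id.prod (.pi fun i => hF.analyticAt_localSection (e i)))

theorem isLocallyConstant_germ_eventuallyEq_zero (hf : AnalyticOnNhd ℂ f Set.univ)
    {X : Type*} [TopologicalSpace X] {p : X → puncturedPlane} (e : ∀ x, ι → Fiber F (p x))
    (hp : Continuous p) (he : ∀ i, Continuous fun x => (e x i).1.1) :
    IsLocallyConstant fun x => hF.germ f (e x) =ᶠ[𝓝 (p x).1] 0 := by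
  refine (IsLocallyConstant.iff_eventually_eq _).mpr fun x => ?_
  have hgerm : ∀ᶠ y in 𝓝 x, hF.germ f (e y) =ᶠ[𝓝 (p y).1] hF.germ f (e x) := by
    have hsection : ∀ᶠ y in 𝓝 x, ∀ i,
        hF.localSection (e y i) =ᶠ[𝓝 (p y).1] hF.localSection (e x i) :=
      eventually_all.mpr fun i => ((he i).continuousAt.eventually
        (hF.eventually_localSection_eventuallyEq (e x i))).mono fun y hy => hy _ _ rfl
    filter_upwards [hsection] with y hy
    filter_upwards [eventually_all.mpr hy] with u hu
    simp only [germ, hu]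
  have hzero : ∀ᶠ u in 𝓝 (p x).1,
      (hF.germ f (e x) =ᶠ[𝓝 u] 0) = (hF.germ f (e x) =ᶠ[𝓝 (p x).1] 0) :=
    eventually_eventuallyEq_zero_eq (hF.analyticAt_germ hf (e x))
  filter_upwards [hgerm, (continuous_subtype_val.comp hp).tendsto x hzero] with y hy hyzero
  exact (propext ⟨hy.symm.trans, hy.trans⟩).trans hyzero

theorem apply_endpoint_eq_zero_of_frequently (hf : AnalyticOnNhd ℂ f Set.univ)
    {e : ι → Fiber F b} (h : ∃ᶠ u in 𝓝[≠] b.1, f (u, fun i => hF.localSection (e i) u) = 0)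
    (γ : Path.Homotopic.Quotient b t) : f (t, fun i => hF.endpoint γ (e i)) = 0 := by
  obtain ⟨γ, rfl⟩ := Path.Homotopic.Quotient.mk_surjective γ
  choose w hw hlift hw0 hw1 using fun i => hF.exists_continuous_lift γ (e i)
  let lift (s : unitInterval) (i : ι) : Fiber F (γ s) := .mk (w i s) (hlift i s)
  have hconst := hF.isLocallyConstant_germ_eventuallyEq_zero hf lift γ.continuous hw
  have hγ0 : (γ 0).1 = b := congr_arg Subtype.val γ.source
  have hstart (i : ι) : hF.localSection (lift 0 i) =ᶠ[𝓝 (γ 0).1] hF.localSection (e i) :=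
    (hF.eventually_localSection_eventuallyEq (e i)).self_of_nhds _ (lift 0 i) (hw0 i)
  have hfreq : ∃ᶠ u in 𝓝[≠] (γ 0).1, hF.germ f (lift 0) u = 0 := by
    refine Frequently.mp (p := fun u => f (u, fun i => hF.localSection (e i) u) = 0)
      (hγ0.symm ▸ h) ?_
    filter_upwards [(eventually_all.mpr hstart).filter_mono nhdsWithin_le_nhds] with u hu hzero
    simpa only [germ, hu] using hzero
  have hzero : hF.germ f (lift 0) =ᶠ[𝓝 (γ 0).1] 0 :=
    (hF.analyticAt_germ hf _).frequently_zero_iff_eventually_zero.mp hfreq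
  have hend : hF.germ f (lift 1) (γ 1) = 0 :=
    ((hconst.apply_eq_of_preconnectedSpace 0 1).mp hzero).self_of_nhds
  simp only [germ, hF.localSection_apply_self] at hend
  simp only [γ.target] at hend
  simp only [← hw1]
  exact hend

end Continuation

/-! ### Conjugation by a field automorphism -/

section Conjugation

variable {G : ℂ[X]} (hG : IsBelyi G) {σ : ℂ ≃+* ℂ}

theorem eventually_exists_equiv_apply_localSection_eq (hσ : G = F.map (σ : ℂ →+* ℂ))
    (b : puncturedPlane) :
    ∀ᶠ t in 𝓝 b.1, σ t = t → ∃ τ : Fiber F b ≃ Fiber G b,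
      ∀ e, σ (hF.localSection e t) = hG.localSection (τ e) t := by
  subst hσ
  filter_upwards [hF.eventually_exists_localSection_eq_endpoint b,
    hG.eventually_exists_localSection_eq_endpoint b] with t ⟨ht, γ, hγ⟩ ⟨_, δ, hδ⟩ hσt
  let conj := Fiber.conj F (t := ⟨t, ht⟩) hσt
  refine ⟨((hF.transport γ).trans conj).trans (hG.transport δ).symm, fun e => ?_⟩
  have hconj : hG.transport δ ((hG.transport δ).symm (conj (hF.transport γ e))) =
      conj (hF.transport γ e) := (hG.transport δ).apply_symm_apply _
  rw [hγ, hδ]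
  exact congr_arg (·.1.1) hconj.symm

theorem exists_equiv_frequently_apply_localSection_eq (hσ : G = F.map (σ : ℂ →+* ℂ))
    (hb : ∃ᶠ t in 𝓝[≠] b.1, σ t = t) :
    ∃ τ : Fiber F b ≃ Fiber G b, ∃ᶠ t in 𝓝[≠] b.1,
      σ t = t ∧ ∀ e, σ (hF.localSection e t) = hG.localSection (τ e) t := by
  have := hF.finite_fiber b
  have := hG.finite_fiber b
  have hτ := hF.eventually_exists_equiv_apply_localSection_eq hG hσ b
  -- `σ` is discontinuous, so the bijection varies with `t`, but only among finitely many.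
  refine frequently_exists.mp (hb.mp ((hτ.filter_mono nhdsWithin_le_nhds).mono ?_))
  exact fun t ht hσt => (ht hσt).imp fun τ hσs => ⟨hσt, hσs⟩

theorem eval_map_eq_eval_endpoint {P : MvPolynomial (Fiber F b) ℂ} {c : ℂ[X]}
    (hc : ∀ (t : puncturedPlane) (γ : Path.Homotopic.Quotient b t),
      c.eval t.1 = MvPolynomial.eval (hF.endpoint γ) P)
    {τ : Fiber F b → Fiber G b}
    (hτ : ∃ᶠ t in 𝓝[≠] b.1, σ t = t ∧ ∀ e, σ (hF.localSection e t) = hG.localSection (τ e) t)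
    (γ : Path.Homotopic.Quotient b t) :
    (c.map (σ : ℂ →+* ℂ)).eval t.1 =
      MvPolynomial.eval (hG.endpoint γ ∘ τ) (MvPolynomial.map (σ : ℂ →+* ℂ) P) := by
  have := hF.finite_fiber b
  cases nonempty_fintype (Fiber F b)
  let f : ℂ × (Fiber F b → ℂ) → ℂ := fun p =>
    (c.map (σ : ℂ →+* ℂ)).eval p.1 - MvPolynomial.eval p.2 (MvPolynomial.map (σ : ℂ →+* ℂ) P)
  have hf : AnalyticOnNhd ℂ f Set.univ := fun p _ =>
    ((AnalyticOnNhd.eval_polynomial _ _ trivial).comp analyticAt_fst).sub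
      ((AnalyticOnNhd.eval_mvPolynomial _ _ trivial).comp analyticAt_snd)
  refine sub_eq_zero.mp (hG.apply_endpoint_eq_zero_of_frequently hf (e := τ) ?_ γ)
  have hshort := hF.eventually_exists_localSection_eq_endpoint b
  refine (hτ.and_eventually (hshort.filter_mono nhdsWithin_le_nhds)).mono ?_
  rintro u ⟨⟨hu, hsection⟩, hu', δ, hδ⟩
  refine sub_eq_zero.mpr ?_
  calc (c.map (σ : ℂ →+* ℂ)).eval u
      = σ (c.eval u) := eval_map_apply_of_apply_eq hu c
    _ = σ (MvPolynomial.eval (hF.endpoint δ) P) := congr_arg σ (hc ⟨u, hu'⟩ δ)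
    _ = MvPolynomial.eval (σ ∘ hF.endpoint δ) (MvPolynomial.map (σ : ℂ →+* ℂ) P) :=
        MvPolynomial.map_eval (σ : ℂ →+* ℂ) _ _
    _ = MvPolynomial.eval (fun e => hG.localSection (τ e) u)
          (MvPolynomial.map (σ : ℂ →+* ℂ) P) := by
        simp only [Function.comp_def, ← hδ, hsection]

theorem exists_equiv_mon_le_map (hσ : G = F.map (σ : ℂ →+* ℂ)) (hb : ∃ᶠ t in 𝓝[≠] b.1, σ t = t) :
    ∃ τ : Fiber F b ≃ Fiber G b,
      Mon hG b ≤ (Mon hF b).map (τ.permCongrHom : Equiv.Perm _ →* Equiv.Perm _) := by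
  have := hF.finite_fiber b
  obtain ⟨τ, hτ⟩ := hF.exists_equiv_frequently_apply_localSection_eq hG hσ hb
  obtain ⟨t, ⟨hσt, hσs⟩, ⟨ht, γ, hγ⟩, _, δ, hδ⟩ := (hτ.and_eventually
    (((hF.eventually_exists_localSection_eq_endpoint b).and
      (hG.eventually_exists_localSection_eq_endpoint b)).filter_mono nhdsWithin_le_nhds)).exists
  have hinj : Function.Injective (hF.endpoint γ) :=
    Fiber.coe_injective.comp (hF.transport γ).injective
  obtain ⟨P, hPinv, hP⟩ := exists_rename_eq_and_eval_comp_ne_zero_iff_mem (Mon hF b) hinj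
  obtain ⟨c, hc⟩ := hF.exists_eval_eq_eval_endpoint hPinv
  have hconj (e) : σ (hF.endpoint γ e) = hG.endpoint δ (τ e) := by rw [← hγ, hσs, hδ]
  refine ⟨τ, fun h hh => ⟨τ.permCongrHom.symm h, (hP _).mp ?_, τ.permCongrHom.apply_symm_apply h⟩⟩
  obtain ⟨α, rfl⟩ := hG.mem_mon_iff.mp hh
  let ρ := τ.permCongrHom.symm (hG.transport α)
  have hfix : MvPolynomial.eval (hF.endpoint γ ∘ ρ) P = MvPolynomial.eval (hF.endpoint γ) P := by
    refine σ.injective ?_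
    calc σ (MvPolynomial.eval (hF.endpoint γ ∘ ρ) P)
        = MvPolynomial.eval (σ ∘ hF.endpoint γ ∘ ρ) (MvPolynomial.map (σ : ℂ →+* ℂ) P) :=
          MvPolynomial.map_eval (σ : ℂ →+* ℂ) _ _
      _ = MvPolynomial.eval (hG.endpoint (α.trans δ) ∘ τ)
            (MvPolynomial.map (σ : ℂ →+* ℂ) P) := by
          congr 2
          funext e
          simp [ρ, hconj, hG.endpoint_trans]
      _ = (c.map (σ : ℂ →+* ℂ)).eval t :=
          (hF.eval_map_eq_eval_endpoint hG hc hτ (t := ⟨t, ht⟩) _).symm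
      _ = σ (c.eval t) := eval_map_apply_of_apply_eq hσt c
      _ = σ (MvPolynomial.eval (hF.endpoint γ) P) := congr_arg σ (hc ⟨t, ht⟩ γ)
  rw [hfix]
  exact (hP 1).mpr (one_mem _)

theorem mon_permIsomorphic_mon_of_map_eq (hσ : G = F.map (σ : ℂ →+* ℂ))
    (hb : ∃ᶠ t in 𝓝[≠] b.1, σ t = t) : PermIsomorphic (Mon hF b) (Mon hG b) := by
  have := hF.finite_fiber b
  have := hG.finite_fiber b
  have hσ' : F = G.map (σ.symm : ℂ →+* ℂ) := by
    rw [hσ, Polynomial.map_map]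
    simp
  have hb' : ∃ᶠ t in 𝓝[≠] b.1, σ.symm t = t :=
    hb.mono fun t ht => σ.symm_apply_eq.mpr ht.symm
  obtain ⟨τ, hτ⟩ := hF.exists_equiv_mon_le_map hG hσ hb
  obtain ⟨υ, hυ⟩ := hG.exists_equiv_mon_le_map hF hσ' hb'
  exact ⟨τ, eq_map_of_le_map_of_le_map hτ hυ⟩

end Conjugation

end IsBelyi

theorem frequently_apply_eq_self (σ : ℂ →+* ℂ) (q : ℚ) : ∃ᶠ t in 𝓝[≠] (q : ℂ), σ t = t := by
  have hseq : Tendsto (fun n : ℕ => ((q + (n + 1 : ℚ)⁻¹ : ℚ) : ℂ)) atTop (𝓝[≠] (q : ℂ)) := by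
    refine tendsto_nhdsWithin_iff.mpr ⟨?_, Eventually.of_forall fun n => ?_⟩
    · simpa using tendsto_const_nhds.add (tendsto_one_div_add_atTop_nhds_zero_nat (𝕜 := ℂ))
    · simp [Nat.cast_add_one_ne_zero]
  exact hseq.frequently (Frequently.of_forall fun n => map_ratCast σ _)

theorem map_iter {R S : Type*} [CommSemiring R] [CommSemiring S] (φ : R →+* S) (f : R[X]) (n : ℕ) :
    (iter f n).map φ = iter (f.map φ) n := by
  have hsemiconj : Function.Semiconj (Polynomial.map φ) f.comp (f.map φ).comp := fun g =>
    Polynomial.map_comp φ f g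
  exact (hsemiconj.iterate_right n X).trans (congr_arg _ (map_X φ))

theorem toComplex_twist {σ : Gal(QBar/ℚ)} {φ : ℂ →+* ℂ}
    (hφ : ∀ x, φ (algebraMap QBar ℂ x) = algebraMap QBar ℂ (σ x)) (f : QBar[X]) :
    toComplex (twist σ f) = (toComplex f).map φ := by
  simp only [toComplex, twist, Polynomial.map_map]
  congr 1
  exact RingHom.ext fun x => (hφ x).symm

theorem theorem4p1_general {F G : ℂ[X]} (hF : IsBelyi F) (hG : IsBelyi G) (σ : ℂ ≃+* ℂ)
    (hσ : G = F.map (σ : ℂ →+* ℂ)) (b b' : puncturedPlane) :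
    PermIsomorphic (Mon hF b) (Mon hG b') := by
  let two : puncturedPlane := ⟨(2 : ℚ), by norm_num⟩
  have htwo : PermIsomorphic (Mon hF two) (Mon hG two) :=
    hF.mon_permIsomorphic_mon_of_map_eq hG hσ (frequently_apply_eq_self (σ : ℂ →+* ℂ) 2)
  exact ((mon_permIsomorphic_mon hF b two).trans htwo).trans (mon_permIsomorphic_mon hG two b')

end BelyiPolynomial

end

open BelyiPolynomial in
theorem theorem4p1 (f g : Polynomial QBar) (hf : f ∈ XDBP) (hg : g ∈ XDBP)
    (σ : Gal(QBar/ℚ)) (hσ : g = twist σ f) (n : ℕ) (hn : 0 < n) (b b' : puncturedPlane) :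
    PermIsomorphic (Mon (isBelyi_toComplex_iter hf n) b)
      (Mon (isBelyi_toComplex_iter hg n) b') := by
  obtain ⟨φ, hφ⟩ := exists_ringEquiv_algebraMap_eq (L := ℂ) σ.toRingEquiv
  refine theorem4p1_general _ _ φ ?_ b b'
  rw [hσ, twist, ← map_iter]
  exact toComplex_twist hφ (iter f n)
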